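/- There exist absolute constants $K>0$ and $c_0>0$ such that the following holds for all integers $1\le k\le n$ and $m$ with $$m\;\ge\;K\,k\log(en/k).$$ Let $\mathbf a_1,\dots,\mathbf a_m$ be independent standard complex Gaussian random vectors in $\mathbb C^n$, i.e. the real and imaginary parts of all coordinates of $\mathbf a_j$ are independent real Gaussians of mean $0$ and variance $\tfrac12$. Let $\mathcal A$ be the linear map from the $n\times n$ complex Hermitian matrices to $\mathbb R^m$ given by $$\mathcal A(X)=(\mathbf a_1^*X\mathbf a_1,\dots,\mathbf a_m^*X\mathbf a_m).$$ Then, with probability at least $1-2\exp(-c_0m)$, the map $\mathcal A$ satisfies the restricted isometry property of order $(2,k)$ with constants $0.12$ and $2.45$: for all Hermitian $X\in\mathbb C^{n\times n}$ with $\operatorname{rank}(X)\le 2$ and at most $k$ nonzero rows, $$0.12\,\|X\|_F\;\le\;\frac1m\,\|\mathcal A(X)\|_1\;\le\;2.45\,\|X\|_F ,$$ where $\|\cdot\|_F$ is the Frobenius norm and $\|\cdot\|_1$ is the $\ell_1$ norm on $\mathbb R^m$. -/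

import Mathlib

open MeasureTheory ProbabilityTheory

noncomputable section

/-- The law of a standard complex Gaussian variable: real and imaginary parts are independent,
real Gaussian, of mean `0` and variance `1/2`. -/
def stdComplexGaussian : Measure ℂ :=
  ((gaussianReal 0 (1 / 2)).prod (gaussianReal 0 (1 / 2))).map Complex.measurableEquivRealProd.symm

/-- The law of a standard complex Gaussian vector in `ℂⁿ`: the coordinates are independent
standard complex Gaussian variables. -/
def stdComplexGaussianVec (n : ℕ) : Measure (Fin n → ℂ) :=
  Measure.pi fun _ => stdComplexGaussian

/-- The real vector space of `n × n` Hermitian matrices. -/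
abbrev HermMat (n : ℕ) : Type := selfAdjoint (Matrix (Fin n) (Fin n) ℂ)

/-- For Hermitian `X` the number `v^* X v` is real, so that it equals its real part. -/
theorem quadForm_re_eq {n : ℕ} (X : HermMat n) (v : Fin n → ℂ) :
    (((star v ⬝ᵥ X.1.mulVec v).re : ℝ) : ℂ) = star v ⬝ᵥ X.1.mulVec v := by
  have hX : X.1.IsHermitian := X.2
  have h := hX.im_star_dotProduct_mulVec_self v
  apply Complex.ext
  · simp
  · simpa using h.symm

/-- The linear map `X ↦ (a_1^* X a_1, …, a_m^* X a_m)` from Hermitian matrices to `ℝᵐ`. -/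
def quadMeas {m n : ℕ} (a : Fin m → Fin n → ℂ) : HermMat n →ₗ[ℝ] (Fin m → ℝ) where
  toFun X j := (star (a j) ⬝ᵥ X.1.mulVec (a j)).re
  map_add' X Y := by
    funext j
    simp [Matrix.add_mulVec, dotProduct_add]
  map_smul' c X := by
    funext j
    simp [Matrix.smul_mulVec, dotProduct_smul]

section
attribute [local instance] Matrix.frobeniusNormedAddCommGroup

/-- The Frobenius norm of a complex matrix. -/
def frobNorm {n : ℕ} (X : Matrix (Fin n) (Fin n) ℂ) : ℝ := ‖X‖

theorem frobNorm_eq {n : ℕ} (X : Matrix (Fin n) (Fin n) ℂ) :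
    frobNorm X = Real.sqrt (∑ i, ∑ j, ‖X i j‖ ^ 2) := by
  rw [frobNorm, Matrix.frobenius_norm_def, Real.sqrt_eq_rpow]
  norm_num

end

/-- The number of nonzero rows of a matrix. -/
def nonzeroRows {n : ℕ} (X : Matrix (Fin n) (Fin n) ℂ) : ℕ := {i : Fin n | X i ≠ 0}.ncard

/-- The map `A` from Hermitian matrices to `ℝᵐ` satisfies the restricted isometry property of
order `(r, k)` with the positive constants `c` and `C`. -/
def SatisfiesRIP {m n : ℕ} (A : HermMat n →ₗ[ℝ] (Fin m → ℝ)) (r k : ℕ) (c C : ℝ) : Prop :=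
  0 < c ∧ 0 < C ∧ ∀ X : HermMat n, X.1.rank ≤ r → nonzeroRows X.1 ≤ k →
    c * frobNorm X.1 ≤ (1 / (m : ℝ)) * ∑ j, |A X j| ∧
      (1 / (m : ℝ)) * ∑ j, |A X j| ≤ C * frobNorm X.1

end

/-!
The proof is a union bound over a net.

A Hermitian matrix of rank at most two is `X = s x x^* + t y y^*` with signs `s`, `t` and orthogonal
`x`, `y` (`exists_signed_decomposition`). Then `a^* X a = s |a^* x|² + t |a^* y|²`, the squared
Frobenius norm of `X` is `‖x‖⁴ + ‖y‖⁴`, and `x`, `y` vanish on the zero rows of `X`. After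
normalization the matrices to be controlled are therefore parametrized, up to a global sign, by
`s t = ±1` and by the sets `orthPairs S` with `S` of cardinality `k`.

*One pair.* The numbers `a^* x` and `a^* y` are independent centred complex Gaussians of variances
`‖x‖²` and `‖y‖²` (`map_sesq`, `indepFun_sesq`, by characteristic functions), so the exponential
moments of `|a^* x|²` and the second and fourth moments of `W = |a^* x|² ± |a^* y|²` are explicit.
The former give `1/m ∑ |a_j^* x|² < 3/2` off an event of probability `exp (-m / 520)`
(`measureReal_upper_tail`). Since `|W| ≥ 3/10 W² - 1/250 W⁴`, the latter bound `E exp (-|W| / 50)`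
away from one, and Chernoff's inequality gives `1/m ∑ |W_j| > 0.13` off an event of the same
probability (`measureReal_lower_tail`).

*All pairs for one `S`.* Take a `1/1000`-net of `orthPairs S` inside `orthPairs S`; a volume argument
provides one with at most `2001 ^ (4 k)` points (`exists_net_orthPairs`). If the two estimates hold
on the net, the first one bounds the operator norm of `x ↦ (a_j^* x)_j` on the vectors supported in
`S` (`norm_sampleMap_sq_le`). This gives the upper isometry constant, and it shows that
`1/m ∑ |W_j|` changes by less than `0.01` between a pair and the nearest point of the net
(`sum_abs_signed_bounds_of_net`).

*Union bound.* There are at most `exp (k log (e n / k))` sets `S`, hence `exp (O (k log (e n / k)))`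
events in all, which `exp (-m / 520)` outweighs as soon as `m` is a large multiple of
`k log (e n / k)` (`card_mul_exp_le`).
-/

/-! ### Nets of controlled cardinality -/

open Metric Module in
/-- Volume comparison: the balls of radius `ε / 2` about the points are disjoint and lie in the
ball of radius `1 + ε / 2`. -/
theorem card_le_of_separated_of_norm_le_one {F : Type*} [NormedAddCommGroup F] [NormedSpace ℝ F]
    [FiniteDimensional ℝ F] {ε : ℝ} (hε : 0 < ε) (s : Finset F) (hs : ∀ c ∈ s, ‖c‖ ≤ 1)
    (h : ∀ c ∈ s, ∀ d ∈ s, c ≠ d → ε ≤ ‖c - d‖) :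
    (s.card : ℝ) ≤ (1 + 2 / ε) ^ finrank ℝ F := by
  borelize F
  let μ : Measure F := Measure.addHaar
  have hδ : 0 < ε / 2 := by positivity
  have hρ : 0 < 1 + ε / 2 := by positivity
  have hdisj : Set.Pairwise (s : Set F) (Function.onFun Disjoint fun c => ball c (ε / 2)) := by
    intro c hc d hd hcd
    apply ball_disjoint_ball
    rw [dist_eq_norm]
    linarith [h c hc d hd hcd]
  have hsub : (⋃ c ∈ s, ball c (ε / 2)) ⊆ ball (0 : F) (1 + ε / 2) := by
    refine Set.iUnion₂_subset fun x hx => ball_subset_ball' ?_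
    rw [dist_zero_right]
    linarith [hs x hx]
  have hvol : (s.card : ENNReal) * ENNReal.ofReal ((ε / 2) ^ finrank ℝ F) * μ (ball 0 1) ≤
      ENNReal.ofReal ((1 + ε / 2) ^ finrank ℝ F) * μ (ball 0 1) := by
    rw [← μ.addHaar_ball_of_pos _ hρ]
    refine le_trans (le_of_eq ?_) (measure_mono hsub)
    rw [measure_biUnion_finset hdisj fun c _ => measurableSet_ball]
    simp only [μ.addHaar_ball_of_pos _ hδ, Finset.sum_const, nsmul_eq_mul, mul_assoc]
  have hcard := ENNReal.toReal_le_of_le_ofReal (by positivity)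
    ((ENNReal.mul_le_mul_iff_left (measure_ball_pos μ _ zero_lt_one).ne'
      measure_ball_lt_top.ne).1 hvol)
  rw [ENNReal.toReal_mul, ENNReal.toReal_natCast, ENNReal.toReal_ofReal (by positivity)] at hcard
  have hfac : (1 + 2 / ε) ^ finrank ℝ F = (1 + ε / 2) ^ finrank ℝ F / (ε / 2) ^ finrank ℝ F := by
    rw [← div_pow]
    congr 1
    field_simp
    ring
  rwa [hfac, le_div_iff₀ (by positivity)]

open Metric Module in
/-- The net is chosen inside `A`, which need not be convex or closed. -/
theorem exists_net_of_norm_le_one {F : Type*} [NormedAddCommGroup F] [NormedSpace ℝ F]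
    [FiniteDimensional ℝ F] {ε : ℝ} (hε : 0 < ε) {A : Set F} (hA : ∀ x ∈ A, ‖x‖ ≤ 1) :
    ∃ N : Finset F, (∀ x ∈ N, x ∈ A) ∧ (N.card : ℝ) ≤ (1 + 2 / ε) ^ finrank ℝ F ∧
      ∀ x ∈ A, ∃ y ∈ N, ‖x - y‖ ≤ ε := by
  set B : ℝ := (1 + 2 / ε) ^ finrank ℝ F with hB
  have hB0 : 0 ≤ B := by positivity
  let δ : NNReal := ⟨ε, hε.le⟩
  have hfin : ∀ C : Finset F, (∀ x ∈ C, x ∈ A) → IsSeparated δ (C : Set F) → C.card ≤ ⌊B⌋₊ := by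
    intro C hCA hC
    refine Nat.le_floor (card_le_of_separated_of_norm_le_one hε C (fun c hc => hA c (hCA c hc)) ?_)
    intro c hc d hd hcd
    have : (δ : ENNReal) < edist c d := hC hc hd hcd
    rw [edist_nndist, ENNReal.coe_lt_coe] at this
    rw [← dist_eq_norm]
    exact (NNReal.coe_lt_coe.2 this).le
  have hpack : packingNumber δ A ≤ (⌊B⌋₊ : ℕ∞) := by
    refine iSup_le fun C => iSup_le fun hCA => iSup_le fun hC => ?_
    by_contra! hlt
    obtain ⟨D, hDC, hD⟩ := Set.exists_subset_encard_eq (Order.add_one_le_of_lt hlt)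
    have hDfin : D.Finite := Set.finite_of_encard_eq_coe (k := ⌊B⌋₊ + 1) (by simpa using hD)
    have hcard := hfin hDfin.toFinset (by simpa using fun x hx => hCA (hDC hx))
      (by simpa using hC.subset hDC)
    rw [hDfin.encard_eq_coe_toFinset_card] at hD
    have : hDfin.toFinset.card = ⌊B⌋₊ + 1 := by exact_mod_cast hD
    omega
  have hcov := (coveringNumber_le_packingNumber δ A).trans hpack
  obtain ⟨C, hCA, hCfin, hC, hcard⟩ := exists_set_encard_eq_coveringNumber
    (ne_top_of_le_ne_top (ENat.natCast_ne_top _) hcov)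
  refine ⟨hCfin.toFinset, by simpa using fun x hx => hCA hx, ?_, ?_⟩
  · rw [← hcard, hCfin.encard_eq_coe_toFinset_card] at hcov
    exact (Nat.le_floor_iff hB0).1 (by exact_mod_cast hcov)
  · intro x hx
    obtain ⟨y, hy, hxy⟩ := hC hx
    refine ⟨y, by simpa using hy, ?_⟩
    have hxy : edist x y ≤ δ := hxy
    rw [edist_nndist, ENNReal.coe_le_coe] at hxy
    rw [← dist_eq_norm]
    exact NNReal.coe_le_coe.2 hxy

/-- The vectors of `ℂⁿ` supported in `S`. -/
def supportedIn {n : ℕ} (S : Finset (Fin n)) : Submodule ℂ (EuclideanSpace ℂ (Fin n)) where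
  carrier := {x | ∀ i ∉ S, x i = 0}
  add_mem' hx hy i hi := by simp [hx i hi, hy i hi]
  zero_mem' i _ := by simp
  smul_mem' c x hx i hi := by simp [hx i hi]

open Module in
theorem finrank_supportedIn_le {n : ℕ} (S : Finset (Fin n)) :
    finrank ℂ (supportedIn S) ≤ S.card := by
  classical
  have hle : supportedIn S ≤ Submodule.span ℂ
      ((S.image fun i => EuclideanSpace.single i (1 : ℂ) : Finset _) : Set _) := by
    intro x hx
    have hsum : x = ∑ i ∈ S, x i • EuclideanSpace.single i (1 : ℂ) := by
      ext j
      simp only [WithLp.ofLp_sum, WithLp.ofLp_smul, Finset.sum_apply, Pi.smul_apply,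
        PiLp.single_apply, smul_eq_mul, mul_ite, mul_one, mul_zero, Finset.sum_ite_eq]
      split_ifs with h
      · rfl
      · exact hx j h
    rw [hsum]
    refine Submodule.sum_mem _ fun i hi => Submodule.smul_mem _ _ (Submodule.subset_span ?_)
    simpa using ⟨i, hi, rfl⟩
  exact (Submodule.finrank_mono hle).trans
    ((finrank_span_finset_le_card _).trans Finset.card_image_le)

/-! ### Orthogonal pairs -/

/-- Pairs of orthogonal vectors `x`, `y` supported in `S` with `‖x‖⁴ + ‖y‖⁴ = 1`. They parametrize
the Hermitian matrices `± x x^* ± y y^*` of rank at most two and Frobenius norm one whose nonzero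
entries have both indices in `S`. -/
def orthPairs {n : ℕ} (S : Finset (Fin n)) :
    Set (EuclideanSpace ℂ (Fin n) × EuclideanSpace ℂ (Fin n)) :=
  {p | p.1 ∈ supportedIn S ∧ p.2 ∈ supportedIn S ∧ inner ℂ p.1 p.2 = 0 ∧
    ‖p.1‖ ^ 4 + ‖p.2‖ ^ 4 = 1}

theorem norm_fst_le_one_of_mem_orthPairs {n : ℕ} {S : Finset (Fin n)}
    {p : EuclideanSpace ℂ (Fin n) × EuclideanSpace ℂ (Fin n)} (hp : p ∈ orthPairs S) :
    ‖p.1‖ ≤ 1 := by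
  have h := hp.2.2.2
  exact (pow_le_one_iff_of_nonneg (norm_nonneg _) (n := 4) (by norm_num)).1
    (by nlinarith [pow_nonneg (norm_nonneg p.2) 4])

theorem norm_snd_le_one_of_mem_orthPairs {n : ℕ} {S : Finset (Fin n)}
    {p : EuclideanSpace ℂ (Fin n) × EuclideanSpace ℂ (Fin n)} (hp : p ∈ orthPairs S) :
    ‖p.2‖ ≤ 1 := by
  have h := hp.2.2.2
  exact (pow_le_one_iff_of_nonneg (norm_nonneg _) (n := 4) (by norm_num)).1
    (by nlinarith [pow_nonneg (norm_nonneg p.1) 4])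

open Module in
/-- The exponent is the real dimension of `ℂ^S × ℂ^S`. -/
theorem exists_net_orthPairs {n : ℕ} (S : Finset (Fin n)) {ε : ℝ} (hε : 0 < ε) :
    ∃ N : Finset (EuclideanSpace ℂ (Fin n) × EuclideanSpace ℂ (Fin n)),
      (∀ p ∈ N, p ∈ orthPairs S) ∧ (N.card : ℝ) ≤ (1 + 2 / ε) ^ (4 * S.card) ∧
      ∀ p ∈ orthPairs S, ∃ q ∈ N, ‖p.1 - q.1‖ ≤ ε ∧ ‖p.2 - q.2‖ ≤ ε := by
  classical
  let f : supportedIn S × supportedIn S → EuclideanSpace ℂ (Fin n) × EuclideanSpace ℂ (Fin n) :=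
    fun p => (p.1, p.2)
  have hA : ∀ p ∈ f ⁻¹' orthPairs S, ‖p‖ ≤ 1 := fun p hp => by
    have h1 : ‖p.1‖ ≤ 1 := norm_fst_le_one_of_mem_orthPairs (p := f p) hp
    have h2 : ‖p.2‖ ≤ 1 := norm_snd_le_one_of_mem_orthPairs (p := f p) hp
    exact max_le h1 h2
  have : FiniteDimensional ℝ (supportedIn S) := FiniteDimensional.complexToReal _
  obtain ⟨N, hNA, hcard, hN⟩ := exists_net_of_norm_le_one hε hA
  have hdim : finrank ℝ (supportedIn S × supportedIn S) ≤ 4 * S.card := by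
    rw [finrank_prod, finrank_real_of_complex]
    linarith [finrank_supportedIn_le S]
  refine ⟨N.image f, ?_, ?_, ?_⟩
  · intro p hp
    obtain ⟨q, hq, rfl⟩ := Finset.mem_image.1 hp
    exact hNA q hq
  · calc ((N.image f).card : ℝ) ≤ N.card := by exact_mod_cast Finset.card_image_le
      _ ≤ _ := hcard
      _ ≤ _ := pow_le_pow_right₀ (by linarith [show (0 : ℝ) < 2 / ε by positivity]) hdim
  · intro p hp
    obtain ⟨q, hq, hpq⟩ := hN (⟨p.1, hp.1⟩, ⟨p.2, hp.2.1⟩) hp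
    rw [Prod.norm_def, max_le_iff] at hpq
    exact ⟨f q, Finset.mem_image_of_mem _ hq, hpq.1, hpq.2⟩

/-! ### The standard complex Gaussian distribution -/

instance : IsProbabilityMeasure stdComplexGaussian :=
  Measure.isProbabilityMeasure_map Complex.measurableEquivRealProd.symm.measurable.aemeasurable

instance (n : ℕ) : IsProbabilityMeasure (stdComplexGaussianVec n) := by
  unfold stdComplexGaussianVec
  infer_instance

theorem gaussianPDFReal_half (x : ℝ) :
    gaussianPDFReal 0 (1 / 2) x = (√Real.pi)⁻¹ * Real.exp (-x ^ 2) := by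
  have h : 2 * Real.pi * ((1 / 2 : NNReal) : ℝ) = Real.pi := by
    push_cast
    ring
  rw [gaussianPDFReal, h]
  simp

theorem stdComplexGaussian_eq_withDensity :
    stdComplexGaussian =
      volume.withDensity fun z : ℂ => ENNReal.ofReal (Real.pi⁻¹ * Real.exp (-‖z‖ ^ 2)) := by
  have hdens : Measurable fun z : ℂ => ENNReal.ofReal (Real.pi⁻¹ * Real.exp (-‖z‖ ^ 2)) := by
    fun_prop
  have hvol := Complex.volume_preserving_equiv_real_prod.symm
  refine Measure.ext_of_lintegral _ fun φ hφ => ?_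
  rw [stdComplexGaussian, gaussianReal_of_var_ne_zero _ (by norm_num),
    prod_withDensity (measurable_gaussianPDF _ _) (measurable_gaussianPDF _ _),
    lintegral_map hφ (MeasurableEquiv.measurable _),
    lintegral_withDensity_eq_lintegral_mul _ (by fun_prop) (by fun_prop),
    lintegral_withDensity_eq_lintegral_mul _ hdens hφ, ← hvol.lintegral_comp (by fun_prop)]
  refine lintegral_congr fun p => ?_
  have hp : ‖Complex.measurableEquivRealProd.symm p‖ ^ 2 = p.1 ^ 2 + p.2 ^ 2 := by
    rw [Complex.sq_norm, Complex.normSq_apply, Complex.measurableEquivRealProd_symm_apply]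
    ring
  have hpi : Real.pi⁻¹ = (√Real.pi)⁻¹ * (√Real.pi)⁻¹ := by
    rw [← mul_inv, Real.mul_self_sqrt Real.pi_pos.le]
  simp only [Pi.mul_apply, gaussianPDF, gaussianPDFReal_half, hp]
  rw [← ENNReal.ofReal_mul (by positivity), neg_add, Real.exp_add, hpi]
  congr 2
  ring

theorem integral_stdComplexGaussian (f : ℂ → ℝ) :
    ∫ z, f z ∂stdComplexGaussian = Real.pi⁻¹ * ∫ z : ℂ, f z * Real.exp (-‖z‖ ^ 2) := by
  rw [stdComplexGaussian_eq_withDensity,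
    integral_withDensity_eq_integral_toReal_smul (by fun_prop) (by simp), ← integral_const_mul]
  refine integral_congr_ae (Filter.Eventually.of_forall fun z => ?_)
  simp only [smul_eq_mul]
  rw [ENNReal.toReal_ofReal (by positivity)]
  ring

theorem integral_norm_pow_stdComplexGaussian (j : ℕ) :
    ∫ z, (‖z‖ ^ 2) ^ j ∂stdComplexGaussian = j.factorial := by
  have h := Complex.integral_rpow_mul_exp_neg_mul_rpow (p := 2) (q := 2 * j) (b := 1)
    (by norm_num) (by linarith [j.cast_nonneg (α := ℝ)]) one_pos
  rw [show ((2 * j + 2 : ℝ) / 2) = j + 1 by ring, Real.Gamma_nat_eq_factorial] at h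
  rw [integral_stdComplexGaussian]
  have hcongr : ∀ z : ℂ, (‖z‖ ^ 2) ^ j * Real.exp (-‖z‖ ^ 2) =
      ‖z‖ ^ (2 * j : ℝ) * Real.exp (-1 * ‖z‖ ^ (2 : ℝ)) := fun z => by
    rw [← pow_mul, ← Real.rpow_natCast ‖z‖ (2 * j), Real.rpow_two]
    simp
  simp_rw [hcongr, h, Real.one_rpow]
  field_simp

theorem integrable_norm_pow_stdComplexGaussian (j : ℕ) :
    Integrable (fun z => (‖z‖ ^ 2) ^ j) stdComplexGaussian := by
  apply Integrable.of_integral_ne_zero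
  rw [integral_norm_pow_stdComplexGaussian]
  positivity

theorem integral_exp_norm_sq_stdComplexGaussian {t : ℝ} (ht : t < 1) :
    ∫ z, Real.exp (t * ‖z‖ ^ 2) ∂stdComplexGaussian = (1 - t)⁻¹ := by
  have h := Complex.integral_rpow_mul_exp_neg_mul_rpow (p := 2) (q := 0) (b := 1 - t)
    (by norm_num) (by norm_num) (by linarith)
  rw [integral_stdComplexGaussian]
  have hcongr : ∀ z : ℂ, Real.exp (t * ‖z‖ ^ 2) * Real.exp (-‖z‖ ^ 2) =
      ‖z‖ ^ (0 : ℝ) * Real.exp (-(1 - t) * ‖z‖ ^ (2 : ℝ)) := fun z => by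
    rw [← Real.exp_add, Real.rpow_two, Real.rpow_zero, one_mul]
    congr 1
    ring
  simp_rw [hcongr, h]
  rw [show (-(0 + 2) / 2 : ℝ) = -1 by norm_num, Real.rpow_neg_one]
  norm_num

theorem integrable_exp_norm_sq_stdComplexGaussian {t : ℝ} (ht : t < 1) :
    Integrable (fun z => Real.exp (t * ‖z‖ ^ 2)) stdComplexGaussian := by
  apply Integrable.of_integral_ne_zero
  rw [integral_exp_norm_sq_stdComplexGaussian ht]
  exact inv_ne_zero (by linarith)

theorem charFun_stdComplexGaussian (t : ℂ) :
    charFun stdComplexGaussian t = Complex.exp (-(‖t‖ ^ 2 / 4 : ℝ)) := by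
  have hinner : ∀ p : ℝ × ℝ, inner ℝ (Complex.measurableEquivRealProd.symm p) t =
      p.1 * t.re + p.2 * t.im := fun p => by
    rw [Complex.measurableEquivRealProd_symm_apply, Complex.inner]
    simp [mul_comm]
  have hchar : ∀ s : ℝ, ∫ x, Complex.exp (((x * s : ℝ) : ℂ) * Complex.I) ∂gaussianReal 0 (1 / 2) =
      Complex.exp (-(s ^ 2 / 4 : ℝ)) := fun s => by
    have h := charFun_gaussianReal (μ := 0) (v := 1 / 2) s
    rw [charFun_apply_real] at h
    rw [show Complex.exp (-(s ^ 2 / 4 : ℝ)) =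
      Complex.exp (s * (0 : ℝ) * Complex.I - ((1 / 2 : NNReal) : ℝ) * s ^ 2 / 2) by
        congr 1; push_cast; ring, ← h]
    refine integral_congr_ae (Filter.Eventually.of_forall fun x => ?_)
    simp only
    congr 1
    push_cast
    ring
  rw [charFun, stdComplexGaussian, integral_map_equiv]
  simp_rw [hinner, Complex.ofReal_add, add_mul, Complex.exp_add]
  rw [integral_prod_mul (fun x : ℝ => Complex.exp (((x * t.re : ℝ) : ℂ) * Complex.I))
    (fun x : ℝ => Complex.exp (((x * t.im : ℝ) : ℂ) * Complex.I)), hchar, hchar, ← Complex.exp_add,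
    Complex.sq_norm, Complex.normSq_apply]
  congr 1
  push_cast
  ring

/-! ### Linear forms of a Gaussian vector -/

/-- The number `a^* x = ∑ᵢ conj aᵢ · xᵢ`. -/
def sesq {n : ℕ} (a : Fin n → ℂ) (x : EuclideanSpace ℂ (Fin n)) : ℂ :=
  ∑ i, starRingEnd ℂ (a i) * x i

theorem measurable_sesq {n : ℕ} (x : EuclideanSpace ℂ (Fin n)) :
    Measurable fun a => sesq a x := by
  unfold sesq
  have : Measurable (starRingEnd ℂ) := Complex.continuous_conj.measurable
  fun_prop

theorem integral_exp_inner_stdComplexGaussianVec {n : ℕ} (w : EuclideanSpace ℂ (Fin n)) :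
    ∫ a, Complex.exp (((∑ i, inner ℝ (a i) (w i) : ℝ) : ℂ) * Complex.I)
      ∂stdComplexGaussianVec n = Complex.exp (-(‖w‖ ^ 2 / 4 : ℝ)) := by
  have hprod : ∀ a : Fin n → ℂ, Complex.exp (((∑ i, inner ℝ (a i) (w i) : ℝ) : ℂ) * Complex.I) =
      ∏ i, Complex.exp (((inner ℝ (a i) (w i) : ℝ) : ℂ) * Complex.I) := fun a => by
    rw [Complex.ofReal_sum, Finset.sum_mul, Complex.exp_sum]
  simp_rw [hprod]
  rw [stdComplexGaussianVec, integral_fintype_prod_eq_prod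
    (f := fun i z => Complex.exp (((inner ℝ z (w i) : ℝ) : ℂ) * Complex.I))]
  have h := fun i => charFun_stdComplexGaussian (w i)
  simp_rw [charFun] at h
  simp_rw [h]
  rw [← Complex.exp_sum, EuclideanSpace.norm_sq_eq, Finset.sum_div, Finset.sum_neg_distrib,
    Complex.ofReal_sum]

theorem inner_sesq {n : ℕ} (a : Fin n → ℂ) (x : EuclideanSpace ℂ (Fin n)) (t : ℂ) :
    inner ℝ (sesq a x) t = ∑ i, inner ℝ (a i) ((starRingEnd ℂ t • x) i) := by
  rw [sesq, sum_inner]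
  refine Finset.sum_congr rfl fun i _ => ?_
  simp [Complex.inner]
  ring

theorem charFun_map_sesq {n : ℕ} (x : EuclideanSpace ℂ (Fin n)) (t : ℂ) :
    charFun ((stdComplexGaussianVec n).map fun a => sesq a x) t =
      Complex.exp (-(‖t‖ ^ 2 * ‖x‖ ^ 2 / 4 : ℝ)) := by
  rw [charFun, integral_map (measurable_sesq x).aemeasurable (by fun_prop)]
  simp_rw [inner_sesq]
  rw [integral_exp_inner_stdComplexGaussianVec, norm_smul, RCLike.norm_conj, mul_pow]

theorem map_sesq {n : ℕ} (x : EuclideanSpace ℂ (Fin n)) :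
    (stdComplexGaussianVec n).map (fun a => sesq a x) =
      stdComplexGaussian.map fun z => ‖x‖ • z := by
  have := Measure.isProbabilityMeasure_map (μ := stdComplexGaussianVec n)
    (measurable_sesq x).aemeasurable
  refine Measure.ext_of_charFun (funext fun t => ?_)
  rw [charFun_map_sesq, charFun_map_smul, charFun_stdComplexGaussian, norm_smul, mul_pow]
  simp [mul_comm]

theorem indepFun_sesq {n : ℕ} {x y : EuclideanSpace ℂ (Fin n)} (hxy : inner ℂ x y = 0) :
    IndepFun (fun a => sesq a x) (fun a => sesq a y) (stdComplexGaussianVec n) := by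
  have hx := measurable_sesq x
  have hy := measurable_sesq y
  rw [indepFun_iff_charFun_prod hx.aemeasurable hy.aemeasurable]
  intro t
  rw [charFun_map_sesq, charFun_map_sesq, charFun,
    integral_map (by fun_prop) (by fun_prop), ← Complex.exp_add]
  have hinner : ∀ a, inner ℝ (WithLp.toLp 2 (sesq a x, sesq a y)) t =
      ∑ i, inner ℝ (a i) ((starRingEnd ℂ t.fst • x + starRingEnd ℂ t.snd • y) i) := fun a => by
    rw [WithLp.prod_inner_apply]
    simp only [inner_sesq, ← Finset.sum_add_distrib, ← inner_add_right]
    rfl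
  have hnorm : ‖starRingEnd ℂ t.fst • x + starRingEnd ℂ t.snd • y‖ ^ 2 =
      ‖t.fst‖ ^ 2 * ‖x‖ ^ 2 + ‖t.snd‖ ^ 2 * ‖y‖ ^ 2 := by
    rw [sq, norm_add_sq_eq_norm_sq_add_norm_sq_of_inner_eq_zero (𝕜 := ℂ) _ _
      (by simp [inner_smul_left, inner_smul_right, hxy])]
    simp only [norm_smul, RCLike.norm_conj]
    ring
  simp_rw [hinner]
  rw [integral_exp_inner_stdComplexGaussianVec, hnorm]
  congr 1
  change _ = _ + -((‖t.snd‖ ^ 2 * ‖y‖ ^ 2 / 4 : ℝ) : ℂ)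
  change _ = -((‖t.fst‖ ^ 2 * ‖x‖ ^ 2 / 4 : ℝ) : ℂ) + _
  push_cast
  ring

theorem integral_comp_norm_sesq {n : ℕ} (x : EuclideanSpace ℂ (Fin n)) {f : ℝ → ℝ}
    (hf : Measurable f) :
    ∫ a, f (‖sesq a x‖ ^ 2) ∂stdComplexGaussianVec n =
      ∫ z, f (‖x‖ ^ 2 * ‖z‖ ^ 2) ∂stdComplexGaussian := by
  have hm : Measurable fun z : ℂ => f (‖z‖ ^ 2) := hf.comp (by fun_prop)
  have h := congrArg (fun μ => ∫ z : ℂ, f (‖z‖ ^ 2) ∂μ) (map_sesq x)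
  rw [integral_map (measurable_sesq x).aemeasurable hm.aestronglyMeasurable,
    integral_map (by fun_prop) hm.aestronglyMeasurable] at h
  simpa only [norm_smul, norm_norm, mul_pow] using h

theorem integrable_comp_norm_sesq {n : ℕ} (x : EuclideanSpace ℂ (Fin n)) {f : ℝ → ℝ}
    (hf : Measurable f)
    (hint : Integrable (fun z => f (‖x‖ ^ 2 * ‖z‖ ^ 2)) stdComplexGaussian) :
    Integrable (fun a => f (‖sesq a x‖ ^ 2)) (stdComplexGaussianVec n) := by
  have hm : Measurable fun z : ℂ => f (‖z‖ ^ 2) := hf.comp (by fun_prop)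
  have h : Integrable (fun z : ℂ => f (‖z‖ ^ 2))
      ((stdComplexGaussianVec n).map fun a => sesq a x) := by
    rw [map_sesq, integrable_map_measure hm.aestronglyMeasurable (by fun_prop)]
    simpa only [Function.comp_def, norm_smul, norm_norm, mul_pow] using hint
  exact h.comp_measurable (measurable_sesq x)

theorem integral_norm_sesq_pow {n : ℕ} (x : EuclideanSpace ℂ (Fin n)) (j : ℕ) :
    ∫ a, (‖sesq a x‖ ^ 2) ^ j ∂stdComplexGaussianVec n = (‖x‖ ^ 2) ^ j * j.factorial := by
  rw [integral_comp_norm_sesq x (f := fun r => r ^ j) (by fun_prop)]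
  simp_rw [mul_pow _ _ j]
  rw [integral_const_mul, integral_norm_pow_stdComplexGaussian]

theorem integrable_norm_sesq_pow {n : ℕ} (x : EuclideanSpace ℂ (Fin n)) (j : ℕ) :
    Integrable (fun a => (‖sesq a x‖ ^ 2) ^ j) (stdComplexGaussianVec n) := by
  refine integrable_comp_norm_sesq x (f := fun r => r ^ j) (by fun_prop) ?_
  simp_rw [mul_pow _ _ j]
  exact (integrable_norm_pow_stdComplexGaussian j).const_mul _

/-! ### Moments of signed sums of squares -/

section Moments

variable {n : ℕ} {x y : EuclideanSpace ℂ (Fin n)}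

theorem indepFun_norm_sesq_pow (hxy : inner ℂ x y = 0) (i j : ℕ) :
    IndepFun (fun a => (‖sesq a x‖ ^ 2) ^ i) (fun a => (‖sesq a y‖ ^ 2) ^ j)
      (stdComplexGaussianVec n) :=
  (indepFun_sesq hxy).comp (φ := fun z : ℂ => (‖z‖ ^ 2) ^ i) (ψ := fun z : ℂ => (‖z‖ ^ 2) ^ j)
    (by fun_prop) (by fun_prop)

theorem integral_norm_sesq_pow_mul (hxy : inner ℂ x y = 0) (i j : ℕ) :
    ∫ a, (‖sesq a x‖ ^ 2) ^ i * (‖sesq a y‖ ^ 2) ^ j ∂stdComplexGaussianVec n =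
      ((‖x‖ ^ 2) ^ i * i.factorial) * ((‖y‖ ^ 2) ^ j * j.factorial) := by
  rw [(indepFun_norm_sesq_pow hxy i j).integral_fun_mul_eq_mul_integral
    (integrable_norm_sesq_pow x i).aestronglyMeasurable
    (integrable_norm_sesq_pow y j).aestronglyMeasurable, integral_norm_sesq_pow,
    integral_norm_sesq_pow]

theorem integrable_norm_sesq_pow_mul (hxy : inner ℂ x y = 0) (i j : ℕ) :
    Integrable (fun a => (‖sesq a x‖ ^ 2) ^ i * (‖sesq a y‖ ^ 2) ^ j)
      (stdComplexGaussianVec n) :=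
  (indepFun_norm_sesq_pow hxy i j).integrable_mul (integrable_norm_sesq_pow x i)
    (integrable_norm_sesq_pow y j)

theorem sq_signed_eq {s : ℝ} (hs : s ^ 2 = 1) (u v : ℝ) :
    (u + s * v) ^ 2 = u ^ 2 * v ^ 0 + 2 * s * (u ^ 1 * v ^ 1) + u ^ 0 * v ^ 2 := by
  linear_combination v ^ 2 * hs

theorem pow_four_signed_eq {s : ℝ} (hs : s ^ 2 = 1) (u v : ℝ) :
    (u + s * v) ^ 4 = u ^ 4 * v ^ 0 + 4 * s * (u ^ 3 * v ^ 1) + 6 * (u ^ 2 * v ^ 2) +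
      4 * s * (u ^ 1 * v ^ 3) + u ^ 0 * v ^ 4 := by
  linear_combination (6 * u ^ 2 * v ^ 2 + 4 * s * u * v ^ 3 + (s ^ 2 + 1) * v ^ 4) * hs

theorem integrable_signed_sq (hxy : inner ℂ x y = 0) {s : ℝ} (hs : s ^ 2 = 1) :
    Integrable (fun a => (‖sesq a x‖ ^ 2 + s * ‖sesq a y‖ ^ 2) ^ 2)
      (stdComplexGaussianVec n) := by
  have h := integrable_norm_sesq_pow_mul hxy
  simp_rw [sq_signed_eq hs]
  exact ((h 2 0).fun_add ((h 1 1).const_mul _)).fun_add (h 0 2)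

theorem integral_signed_sq (hxy : inner ℂ x y = 0) {s : ℝ} (hs : s ^ 2 = 1) :
    ∫ a, (‖sesq a x‖ ^ 2 + s * ‖sesq a y‖ ^ 2) ^ 2 ∂stdComplexGaussianVec n =
      2 * (‖x‖ ^ 4 + ‖y‖ ^ 4) + 2 * (s * (‖x‖ ^ 2 * ‖y‖ ^ 2)) := by
  have h := integrable_norm_sesq_pow_mul hxy
  simp_rw [sq_signed_eq hs]
  rw [integral_add ((h 2 0).fun_add ((h 1 1).const_mul _)) (h 0 2),
    integral_add (h 2 0) ((h 1 1).const_mul _), integral_const_mul]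
  simp only [integral_norm_sesq_pow_mul hxy]
  norm_num [Nat.factorial]
  ring

theorem integrable_signed_pow_four (hxy : inner ℂ x y = 0) {s : ℝ} (hs : s ^ 2 = 1) :
    Integrable (fun a => (‖sesq a x‖ ^ 2 + s * ‖sesq a y‖ ^ 2) ^ 4)
      (stdComplexGaussianVec n) := by
  have h := integrable_norm_sesq_pow_mul hxy
  simp_rw [pow_four_signed_eq hs]
  exact ((((h 4 0).fun_add ((h 3 1).const_mul _)).fun_add ((h 2 2).const_mul _)).fun_add
    ((h 1 3).const_mul _)).fun_add (h 0 4)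

theorem integral_signed_pow_four (hxy : inner ℂ x y = 0) {s : ℝ} (hs : s ^ 2 = 1) :
    ∫ a, (‖sesq a x‖ ^ 2 + s * ‖sesq a y‖ ^ 2) ^ 4 ∂stdComplexGaussianVec n =
      24 * ((‖x‖ ^ 4 + ‖y‖ ^ 4) ^ 2 + s * (‖x‖ ^ 2 * ‖y‖ ^ 2) * (‖x‖ ^ 4 + ‖y‖ ^ 4) -
        (s * (‖x‖ ^ 2 * ‖y‖ ^ 2)) ^ 2) := by
  have h := integrable_norm_sesq_pow_mul hxy
  simp_rw [pow_four_signed_eq hs]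
  rw [integral_add ((((h 4 0).fun_add ((h 3 1).const_mul _)).fun_add ((h 2 2).const_mul _)).fun_add
      ((h 1 3).const_mul _)) (h 0 4),
    integral_add (((h 4 0).fun_add ((h 3 1).const_mul _)).fun_add ((h 2 2).const_mul _))
      ((h 1 3).const_mul _),
    integral_add ((h 4 0).fun_add ((h 3 1).const_mul _)) ((h 2 2).const_mul _),
    integral_add (h 4 0) ((h 3 1).const_mul _)]
  simp only [integral_const_mul, integral_norm_sesq_pow_mul hxy]
  norm_num [Nat.factorial]
  linear_combination (24 * (‖x‖ ^ 2 * ‖y‖ ^ 2) ^ 2) * hs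

/-! ### Exponential moments -/

theorem integrable_exp_norm_sesq_sq (hx : ‖x‖ ≤ 1) :
    Integrable (fun a => Real.exp (1 / 4 * ‖sesq a x‖ ^ 2)) (stdComplexGaussianVec n) := by
  refine integrable_comp_norm_sesq x (f := fun r => Real.exp (1 / 4 * r)) (by fun_prop) ?_
  simp_rw [← mul_assoc]
  exact integrable_exp_norm_sq_stdComplexGaussian (by nlinarith [norm_nonneg x])

/-- `|a^* x|²` has the law of `‖x‖²` times a standard exponential variable. -/
theorem integral_exp_norm_sesq_sq_le (hx : ‖x‖ ≤ 1) :
    ∫ a, Real.exp (1 / 4 * ‖sesq a x‖ ^ 2) ∂stdComplexGaussianVec n ≤ Real.exp (1 / 3) := by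
  have hx2 : ‖x‖ ^ 2 ≤ 1 := pow_le_one₀ (norm_nonneg _) hx
  rw [integral_comp_norm_sesq x (f := fun r => Real.exp (1 / 4 * r)) (by fun_prop)]
  simp_rw [← mul_assoc]
  rw [integral_exp_norm_sq_stdComplexGaussian (by linarith)]
  calc (1 - 1 / 4 * ‖x‖ ^ 2)⁻¹ ≤ (3 / 4)⁻¹ := inv_anti₀ (by norm_num) (by linarith)
    _ ≤ Real.exp (1 / 3) := by linarith [Real.add_one_le_exp (1 / 3 : ℝ)]

/-- The bound `|w| ≥ 3/10 w² - 1/250 w⁴` is tangent at `|w| = 5`; it turns the second and fourth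
moments into a lower bound for the first absolute moment. -/
theorem exp_neg_abs_le (w : ℝ) :
    Real.exp (1 / 50 * -|w|) ≤ 1 - 29 / 5000 * w ^ 2 + 1 / 12500 * w ^ 4 := by
  have h0 : 0 ≤ |w| := abs_nonneg w
  have habs : 3 / 10 * |w| ^ 2 - 1 / 250 * |w| ^ 4 ≤ |w| := by
    have h : 0 ≤ 1 / 250 * (|w| * ((|w| - 5) ^ 2 * (|w| + 10))) := by positivity
    linarith [h]
  have hexp : Real.exp (1 / 50 * -|w|) ≤ 1 - 1 / 50 * |w| + (1 / 50 * |w|) ^ 2 / 2 := by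
    have h := Real.quadratic_le_exp_of_nonneg (x := 1 / 50 * |w|) (by positivity)
    set r := 1 / 50 * |w| with hr
    have hr0 : 0 ≤ r := by positivity
    rw [show 1 / 50 * -|w| = -r by rw [hr]; ring, Real.exp_neg]
    rw [inv_le_iff_one_le_mul₀ (Real.exp_pos r)]
    have hq : 0 < 1 - r + r ^ 2 / 2 := by nlinarith [sq_nonneg (r - 1)]
    calc (1 : ℝ) ≤ (1 - r + r ^ 2 / 2) * (1 + r + r ^ 2 / 2) := by nlinarith [sq_nonneg (r ^ 2)]
      _ ≤ (1 - r + r ^ 2 / 2) * Real.exp r := by gcongr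
  have h4 : |w| ^ 4 = w ^ 4 := by rw [show (4 : ℕ) = 2 * 2 by norm_num, pow_mul, sq_abs, pow_mul]
  rw [h4, sq_abs] at habs
  rw [mul_pow, sq_abs] at hexp
  linarith

theorem measurable_signed (x y : EuclideanSpace ℂ (Fin n)) (s : ℝ) :
    Measurable fun a => |‖sesq a x‖ ^ 2 + s * ‖sesq a y‖ ^ 2| := by
  have hx := measurable_sesq x
  have hy := measurable_sesq y
  simp_rw [← Real.norm_eq_abs]
  fun_prop

theorem integrable_exp_neg_abs_signed (x y : EuclideanSpace ℂ (Fin n)) (s : ℝ) :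
    Integrable (fun a => Real.exp (1 / 50 * -|‖sesq a x‖ ^ 2 + s * ‖sesq a y‖ ^ 2|))
      (stdComplexGaussianVec n) := by
  have hm := measurable_signed x y s
  refine Integrable.of_bound (C := 1)
    (hm.neg.const_mul (1 / 50)).exp.aestronglyMeasurable (Filter.Eventually.of_forall fun a => ?_)
  rw [Real.norm_eq_abs, Real.abs_exp, Real.exp_le_one_iff]
  linarith [abs_nonneg (‖sesq a x‖ ^ 2 + s * ‖sesq a y‖ ^ 2)]

theorem integral_exp_neg_abs_signed_le (hxy : inner ℂ x y = 0) (hnorm : ‖x‖ ^ 4 + ‖y‖ ^ 4 = 1)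
    {s : ℝ} (hs : s ^ 2 = 1) :
    ∫ a, Real.exp (1 / 50 * -|‖sesq a x‖ ^ 2 + s * ‖sesq a y‖ ^ 2|) ∂stdComplexGaussianVec n ≤
      Real.exp (-(1 / 220)) := by
  have h2 := integrable_signed_sq hxy hs
  have h4 := integrable_signed_pow_four hxy hs
  have h12 : Integrable (fun a => 1 - 29 / 5000 * (‖sesq a x‖ ^ 2 + s * ‖sesq a y‖ ^ 2) ^ 2)
      (stdComplexGaussianVec n) := (integrable_const (1 : ℝ)).sub (h2.const_mul _)
  have hbound := integral_mono (integrable_exp_neg_abs_signed x y s)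
    (h12.fun_add (h4.const_mul (1 / 12500)))
    (fun a => exp_neg_abs_le (‖sesq a x‖ ^ 2 + s * ‖sesq a y‖ ^ 2))
  refine hbound.trans ?_
  rw [integral_add h12 (h4.const_mul (1 / 12500)), integral_sub (integrable_const 1)
      (h2.const_mul (29 / 5000)),
    integral_const_mul, integral_const_mul, integral_signed_sq hxy hs,
    integral_signed_pow_four hxy hs, hnorm]
  simp only [integral_const, probReal_univ, smul_eq_mul]
  set r := s * (‖x‖ ^ 2 * ‖y‖ ^ 2) with hr
  have hr2 : -(1 / 2) ≤ r := by
    have hq : ‖x‖ ^ 2 * ‖y‖ ^ 2 ≤ 1 / 2 := by nlinarith [sq_nonneg (‖x‖ ^ 2 - ‖y‖ ^ 2)]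
    have hsle : -1 ≤ s := by nlinarith
    have hq0 : 0 ≤ ‖x‖ ^ 2 * ‖y‖ ^ 2 := by positivity
    nlinarith
  nlinarith [Real.add_one_le_exp (-(1 / 220) : ℝ)]

end Moments

/-! ### Tail bounds -/

/-- Chernoff's bound for the sum of `Y` over an independent sample. -/
theorem measureReal_le_sum_le_exp {n m : ℕ} {Ω : Type*} [MeasurableSpace Ω] {P : Measure Ω}
    [IsProbabilityMeasure P] {a : Fin m → Ω → (Fin n → ℂ)}
    (ha : ∀ j, HasLaw (a j) (stdComplexGaussianVec n) P) (hind : iIndepFun a P)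
    {Y : (Fin n → ℂ) → ℝ} (hY : Measurable Y) {t b : ℝ} (ht : 0 ≤ t)
    (hint : Integrable (fun v => Real.exp (t * Y v)) (stdComplexGaussianVec n))
    (hb : ∫ v, Real.exp (t * Y v) ∂stdComplexGaussianVec n ≤ Real.exp b) (ε : ℝ) :
    P.real {ω | ε * m ≤ ∑ j, Y (a j ω)} ≤ Real.exp ((b - t * ε) * m) := by
  have hexp : Measurable fun v => Real.exp (t * Y v) := by fun_prop
  have hYm : ∀ j, AEMeasurable (fun ω => Y (a j ω)) P := fun j =>
    hY.comp_aemeasurable (ha j).aemeasurable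
  have hYind : iIndepFun (fun j ω => Y (a j ω)) P := hind.comp (fun _ => Y) fun _ => hY
  have hYint : ∀ j ∈ Finset.univ, Integrable (fun ω => Real.exp (t * Y (a j ω))) P := fun j _ => by
    have h : Integrable (fun v => Real.exp (t * Y v)) (P.map (a j)) := by rwa [(ha j).map_eq]
    exact h.comp_aemeasurable (ha j).aemeasurable
  have hmgf : ∀ j, mgf (fun ω => Y (a j ω)) P t ≤ Real.exp b := fun j => by
    refine le_trans (le_of_eq ?_) hb
    exact (ha j).integral_comp (f := fun v => Real.exp (t * Y v)) hexp.aestronglyMeasurable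
  have hsum_int : Integrable (fun ω => Real.exp (t * (∑ j, fun ω => Y (a j ω)) ω)) P := by
    apply Integrable.of_integral_ne_zero
    change mgf (∑ j, fun ω => Y (a j ω)) P t ≠ 0
    rw [hYind.mgf_sum₀ hYm]
    exact Finset.prod_ne_zero_iff.2 fun j hj => (mgf_pos (hYint j hj)).ne'
  have hsum := measure_ge_le_exp_mul_mgf (ε * m) ht hsum_int
  rw [hYind.mgf_sum₀ hYm] at hsum
  simp only [Finset.sum_apply] at hsum
  refine hsum.trans ?_
  calc Real.exp (-t * (ε * m)) * ∏ j, mgf (fun ω => Y (a j ω)) P t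
      ≤ Real.exp (-t * (ε * m)) * ∏ _j : Fin m, Real.exp b := by
        gcongr
        · exact fun _ _ => mgf_nonneg
        · exact hmgf _
    _ = Real.exp ((b - t * ε) * m) := by
        rw [Finset.prod_const, Finset.card_univ, Fintype.card_fin, ← Real.exp_nat_mul,
          ← Real.exp_add]
        congr 1
        ring

theorem measureReal_upper_tail {n m : ℕ} {Ω : Type*} [MeasurableSpace Ω] {P : Measure Ω}
    [IsProbabilityMeasure P] {a : Fin m → Ω → (Fin n → ℂ)}
    (ha : ∀ j, HasLaw (a j) (stdComplexGaussianVec n) P) (hind : iIndepFun a P)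
    {x : EuclideanSpace ℂ (Fin n)} (hx : ‖x‖ ≤ 1) :
    P.real {ω | 1.5 * m ≤ ∑ j, ‖sesq (a j ω) x‖ ^ 2} ≤ Real.exp (-(1 / 520) * m) := by
  have hm := measurable_sesq x
  refine (measureReal_le_sum_le_exp ha hind (Y := fun v => ‖sesq v x‖ ^ 2) (by fun_prop)
    (by norm_num) (integrable_exp_norm_sesq_sq hx) (integral_exp_norm_sesq_sq_le hx) _).trans ?_
  gcongr
  norm_num

theorem measureReal_lower_tail {n m : ℕ} {Ω : Type*} [MeasurableSpace Ω] {P : Measure Ω}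
    [IsProbabilityMeasure P] {a : Fin m → Ω → (Fin n → ℂ)}
    (ha : ∀ j, HasLaw (a j) (stdComplexGaussianVec n) P) (hind : iIndepFun a P)
    {x y : EuclideanSpace ℂ (Fin n)} (hxy : inner ℂ x y = 0) (hnorm : ‖x‖ ^ 4 + ‖y‖ ^ 4 = 1)
    {s : ℝ} (hs : s ^ 2 = 1) :
    P.real {ω | ∑ j, |‖sesq (a j ω) x‖ ^ 2 + s * ‖sesq (a j ω) y‖ ^ 2| ≤ 0.13 * m} ≤
      Real.exp (-(1 / 520) * m) := by
  have h := measureReal_le_sum_le_exp ha hind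
    (Y := fun v => -|‖sesq v x‖ ^ 2 + s * ‖sesq v y‖ ^ 2|) (measurable_signed x y s).neg
    (by norm_num) (integrable_exp_neg_abs_signed x y s)
    (integral_exp_neg_abs_signed_le hxy hnorm hs) (-0.13)
  simp only [Finset.sum_neg_distrib, neg_mul, neg_le_neg_iff] at h
  refine h.trans ?_
  gcongr
  norm_num

/-! ### From a net to all orthogonal pairs -/

theorem sum_abs_norm_sq_sub_le {m : ℕ} (u v : EuclideanSpace ℂ (Fin m)) :
    ∑ j, |‖u j‖ ^ 2 - ‖v j‖ ^ 2| ≤ ‖u - v‖ * (‖u‖ + ‖v‖) := by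
  have hcs : ∀ f g : EuclideanSpace ℂ (Fin m), ∑ j, ‖f j‖ * ‖g j‖ ≤ ‖f‖ * ‖g‖ := fun f g => by
    rw [EuclideanSpace.norm_eq, EuclideanSpace.norm_eq]
    exact Real.sum_mul_le_sqrt_mul_sqrt _ _ _
  calc ∑ j, |‖u j‖ ^ 2 - ‖v j‖ ^ 2|
      ≤ ∑ j, (‖(u - v) j‖ * ‖u j‖ + ‖(u - v) j‖ * ‖v j‖) := by
        refine Finset.sum_le_sum fun j _ => ?_
        rw [sq_sub_sq, abs_mul, ← mul_add, mul_comm,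
          abs_of_nonneg (add_nonneg (norm_nonneg _) (norm_nonneg _))]
        exact mul_le_mul_of_nonneg_right (abs_norm_sub_norm_le _ _)
          (add_nonneg (norm_nonneg _) (norm_nonneg _))
    _ ≤ ‖u - v‖ * ‖u‖ + ‖u - v‖ * ‖v‖ := by
        rw [Finset.sum_add_distrib]
        exact add_le_add (hcs _ _) (hcs _ _)
    _ = ‖u - v‖ * (‖u‖ + ‖v‖) := by ring

/-- The linear map `x ↦ (a_1^* x, …, a_m^* x)` on the vectors supported in `S`. -/
noncomputable def sampleMap {m n : ℕ} (a : Fin m → Fin n → ℂ) (S : Finset (Fin n)) :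
    supportedIn S →L[ℂ] EuclideanSpace ℂ (Fin m) :=
  LinearMap.toContinuousLinearMap
    { toFun := fun x => WithLp.toLp 2 fun j => sesq (a j) x
      map_add' := fun x y => by
        ext j
        simp [sesq, mul_add, Finset.sum_add_distrib]
      map_smul' := fun c x => by
        ext j
        simp only [sesq, Submodule.coe_smul, PiLp.smul_apply, smul_eq_mul, RingHom.id_apply,
          Finset.mul_sum]
        exact Finset.sum_congr rfl fun i _ => by ring }

theorem norm_sampleMap_sq {m n : ℕ} (a : Fin m → Fin n → ℂ) (S : Finset (Fin n))
    (x : supportedIn S) : ‖sampleMap a S x‖ ^ 2 = ∑ j, ‖sesq (a j) x‖ ^ 2 :=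
  EuclideanSpace.norm_sq_eq _

section Net

variable {m n : ℕ} {a : Fin m → Fin n → ℂ} {S : Finset (Fin n)}
  {N : Finset (EuclideanSpace ℂ (Fin n) × EuclideanSpace ℂ (Fin n))}

/-- A unit vector `u` enters through the pair `(u, 0)`; approximating it by the first entry `q` of a
pair of the net gives `‖L u‖ ≤ ‖L q‖ + ‖L‖ / 1000`, and the last term is absorbed on the left. -/
theorem norm_sampleMap_sq_le (hNS : ∀ p ∈ N, p ∈ orthPairs S)
    (hN : ∀ p ∈ orthPairs S, ∃ q ∈ N, ‖p.1 - q.1‖ ≤ 1 / 1000 ∧ ‖p.2 - q.2‖ ≤ 1 / 1000)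
    (hup : ∀ p ∈ N, ∑ j, ‖sesq (a j) p.1‖ ^ 2 ≤ 1.5 * m) :
    ‖sampleMap a S‖ ^ 2 ≤ 1.51 * m := by
  set L := sampleMap a S with hL
  have hbound : ∀ x : supportedIn S, ‖L x‖ ≤ (√(1.5 * m) + ‖L‖ * (1 / 1000)) * ‖x‖ := by
    intro x
    rcases eq_or_ne x 0 with rfl | hx
    · simp
    have hx0 : 0 < ‖x‖ := norm_pos_iff.2 hx
    set u : supportedIn S := ((‖x‖⁻¹ : ℝ) : ℂ) • x with hu
    have hu1 : ‖u‖ = 1 := by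
      rw [hu, norm_smul, Complex.norm_real, norm_inv, norm_norm, inv_mul_cancel₀ hx0.ne']
    have hup' : ((u : EuclideanSpace ℂ (Fin n)), (0 : EuclideanSpace ℂ (Fin n))) ∈ orthPairs S := by
      refine ⟨u.2, Submodule.zero_mem _, inner_zero_right _, ?_⟩
      have : ‖(u : EuclideanSpace ℂ (Fin n))‖ = 1 := hu1
      simp [this]
    obtain ⟨q, hq, hq1, -⟩ := hN _ hup'
    let q' : supportedIn S := ⟨q.1, (hNS q hq).1⟩
    have hLq : ‖L q'‖ ≤ √(1.5 * m) := by
      refine Real.le_sqrt_of_sq_le ?_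
      rw [hL, norm_sampleMap_sq]
      exact hup q hq
    have hLu : ‖L u‖ ≤ √(1.5 * m) + ‖L‖ * (1 / 1000) := by
      calc ‖L u‖ = ‖L q' + L (u - q')‖ := by rw [← map_add, add_sub_cancel]
        _ ≤ ‖L q'‖ + ‖L (u - q')‖ := norm_add_le _ _
        _ ≤ √(1.5 * m) + ‖L‖ * (1 / 1000) :=
          add_le_add hLq (L.le_opNorm_of_le hq1)
    have hxu : x = ((‖x‖ : ℝ) : ℂ) • u := by
      rw [hu, smul_smul, ← Complex.ofReal_mul, mul_inv_cancel₀ hx0.ne', Complex.ofReal_one,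
        one_smul]
    calc ‖L x‖ = ‖x‖ * ‖L u‖ := by
          conv_lhs => rw [hxu]
          rw [map_smul, norm_smul, Complex.norm_real, norm_norm]
      _ ≤ ‖x‖ * (√(1.5 * m) + ‖L‖ * (1 / 1000)) := by gcongr
      _ = _ := mul_comm _ _
  have hop : ‖L‖ ≤ √(1.5 * m) + ‖L‖ * (1 / 1000) := L.opNorm_le_bound (by positivity) hbound
  have hsq := Real.sq_sqrt (show (0 : ℝ) ≤ 1.5 * m by positivity)
  have h2 : (0.999 * ‖L‖) ^ 2 ≤ 1.5 * m := by
    rw [← hsq]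
    exact pow_le_pow_left₀ (by positivity) (by linarith) 2
  nlinarith [m.cast_nonneg (α := ℝ)]

theorem sum_abs_norm_sesq_sq_sub_le {δ : ℝ}
    {x y : EuclideanSpace ℂ (Fin n)} (hx : x ∈ supportedIn S) (hy : y ∈ supportedIn S)
    (hx1 : ‖x‖ ≤ 1) (hy1 : ‖y‖ ≤ 1) (hxy : ‖x - y‖ ≤ δ) :
    ∑ j, |‖sesq (a j) x‖ ^ 2 - ‖sesq (a j) y‖ ^ 2| ≤ 2 * δ * ‖sampleMap a S‖ ^ 2 := by
  set L := sampleMap a S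
  have h := sum_abs_norm_sq_sub_le (L ⟨x, hx⟩) (L ⟨y, hy⟩)
  have h1 : ‖L ⟨x, hx⟩ - L ⟨y, hy⟩‖ ≤ ‖L‖ * δ := by
    rw [← map_sub]
    exact L.le_opNorm_of_le hxy
  have h2 : ‖L ⟨x, hx⟩‖ ≤ ‖L‖ * 1 := L.le_opNorm_of_le hx1
  have h3 : ‖L ⟨y, hy⟩‖ ≤ ‖L‖ * 1 := L.le_opNorm_of_le hy1
  refine h.trans ?_
  calc ‖L ⟨x, hx⟩ - L ⟨y, hy⟩‖ * (‖L ⟨x, hx⟩‖ + ‖L ⟨y, hy⟩‖)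
      ≤ (‖L‖ * δ) * (‖L‖ * 1 + ‖L‖ * 1) := mul_le_mul h1 (add_le_add h2 h3)
        (add_nonneg (norm_nonneg _) (norm_nonneg _)) ((norm_nonneg _).trans h1)
    _ = 2 * δ * ‖L‖ ^ 2 := by ring

theorem sum_abs_signed_bounds_of_net (hNS : ∀ p ∈ N, p ∈ orthPairs S)
    (hN : ∀ p ∈ orthPairs S, ∃ q ∈ N, ‖p.1 - q.1‖ ≤ 1 / 1000 ∧ ‖p.2 - q.2‖ ≤ 1 / 1000)
    (hup : ∀ p ∈ N, ∑ j, ‖sesq (a j) p.1‖ ^ 2 ≤ 1.5 * m) {s : ℝ} (hs : s ^ 2 = 1)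
    (hlow : ∀ p ∈ N, 0.13 * m ≤ ∑ j, |‖sesq (a j) p.1‖ ^ 2 + s * ‖sesq (a j) p.2‖ ^ 2|)
    {p : EuclideanSpace ℂ (Fin n) × EuclideanSpace ℂ (Fin n)} (hp : p ∈ orthPairs S) :
    0.12 * m ≤ ∑ j, |‖sesq (a j) p.1‖ ^ 2 + s * ‖sesq (a j) p.2‖ ^ 2| ∧
      ∑ j, |‖sesq (a j) p.1‖ ^ 2 + s * ‖sesq (a j) p.2‖ ^ 2| ≤ 2.45 * m := by
  have hM := norm_sampleMap_sq_le hNS hN hup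
  have hm : (0 : ℝ) ≤ m := m.cast_nonneg
  have habs : |s| = 1 := by rwa [← sq_eq_sq₀ (abs_nonneg s) zero_le_one, sq_abs, one_pow]
  constructor
  · obtain ⟨q, hq, hq1, hq2⟩ := hN p hp
    have hqS := hNS q hq
    have h1 := sum_abs_norm_sesq_sq_sub_le hqS.1 hp.1 (norm_fst_le_one_of_mem_orthPairs hqS)
      (norm_fst_le_one_of_mem_orthPairs hp) ((norm_sub_rev _ _).trans_le hq1) (a := a)
    have h2 := sum_abs_norm_sesq_sq_sub_le hqS.2.1 hp.2.1
      (norm_snd_le_one_of_mem_orthPairs hqS)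
      (norm_snd_le_one_of_mem_orthPairs hp) ((norm_sub_rev _ _).trans_le hq2) (a := a)
    have htri : ∑ j, |‖sesq (a j) q.1‖ ^ 2 + s * ‖sesq (a j) q.2‖ ^ 2| ≤
        ∑ j, |‖sesq (a j) p.1‖ ^ 2 + s * ‖sesq (a j) p.2‖ ^ 2| +
        (∑ j, |‖sesq (a j) q.1‖ ^ 2 - ‖sesq (a j) p.1‖ ^ 2| +
          ∑ j, |‖sesq (a j) q.2‖ ^ 2 - ‖sesq (a j) p.2‖ ^ 2|) := by
      rw [← Finset.sum_add_distrib, ← Finset.sum_add_distrib]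
      refine Finset.sum_le_sum fun j _ => ?_
      set A := ‖sesq (a j) q.1‖ ^ 2
      set B := ‖sesq (a j) q.2‖ ^ 2
      set A' := ‖sesq (a j) p.1‖ ^ 2
      set B' := ‖sesq (a j) p.2‖ ^ 2
      calc |A + s * B| = |(A' + s * B') + ((A - A') + s * (B - B'))| := by congr 1; ring
        _ ≤ |A' + s * B'| + (|A - A'| + |s * (B - B')|) :=
          (abs_add_le _ _).trans (by gcongr; exact abs_add_le _ _)
        _ = _ := by rw [abs_mul, habs, one_mul]
    linarith [hlow q hq]
  · -- `‖x‖² + ‖y‖² ≤ √2 ≤ 3 / 2` for the pair `(x, y)`.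
    have hsum : ‖p.1‖ ^ 2 + ‖p.2‖ ^ 2 ≤ 3 / 2 := by
      have h := hp.2.2.2
      nlinarith [sq_nonneg (‖p.1‖ ^ 2 - ‖p.2‖ ^ 2)]
    have hop : ∀ x (hx : x ∈ supportedIn S),
        ∑ j, ‖sesq (a j) x‖ ^ 2 ≤ ‖sampleMap a S‖ ^ 2 * ‖x‖ ^ 2 := fun x hx => by
      rw [← norm_sampleMap_sq a S ⟨x, hx⟩, ← mul_pow]
      exact pow_le_pow_left₀ (norm_nonneg _) ((sampleMap a S).le_opNorm ⟨x, hx⟩) 2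
    calc ∑ j, |‖sesq (a j) p.1‖ ^ 2 + s * ‖sesq (a j) p.2‖ ^ 2|
        ≤ ∑ j, (‖sesq (a j) p.1‖ ^ 2 + ‖sesq (a j) p.2‖ ^ 2) := by
          refine Finset.sum_le_sum fun j _ => (abs_add_le _ _).trans (le_of_eq ?_)
          rw [abs_mul, habs, one_mul, abs_of_nonneg (by positivity), abs_of_nonneg (by positivity)]
      _ ≤ ‖sampleMap a S‖ ^ 2 * (‖p.1‖ ^ 2 + ‖p.2‖ ^ 2) := by
          rw [Finset.sum_add_distrib, mul_add]
          exact add_le_add (hop _ hp.1) (hop _ hp.2.1)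
      _ ≤ 1.51 * m * (3 / 2) := mul_le_mul hM hsum (by positivity) (by positivity)
      _ ≤ 2.45 * m := by linarith

end Net

/-! ### Hermitian matrices of rank at most two -/

section Spectral

variable {n : ℕ}

/-- The vectors are eigenvectors scaled by the square roots of the absolute eigenvalues, and the
signs are those of the eigenvalues. -/
theorem exists_signed_decomposition {X : Matrix (Fin n) (Fin n) ℂ} (hX : X.IsHermitian)
    (hrank : X.rank ≤ 2) :
    ∃ (x y : EuclideanSpace ℂ (Fin n)) (s t : ℝ), s ^ 2 = 1 ∧ t ^ 2 = 1 ∧ inner ℂ x y = 0 ∧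
      ∀ i j, X i j = s * (x i * starRingEnd ℂ (x j)) + t * (y i * starRingEnd ℂ (y j)) := by
  classical
  set b := hX.eigenvectorBasis
  set l := hX.eigenvalues
  let v : Fin n → EuclideanSpace ℂ (Fin n) := fun k => ((√|l k| : ℝ) : ℂ) • b k
  let s : Fin n → ℝ := fun k => if l k < 0 then -1 else 1
  have hs : ∀ k, s k ^ 2 = 1 := fun k => by
    simp only [s]
    split_ifs <;> norm_num
  have hsl : ∀ k, s k * |l k| = l k := fun k => by
    simp only [s]
    split_ifs with h
    · rw [abs_of_neg h]
      ring
    · rw [abs_of_nonneg (not_lt.1 h), one_mul]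
  have hterm : ∀ k i j, (l k : ℂ) * (b k i * starRingEnd ℂ (b k j)) =
      s k * (v k i * starRingEnd ℂ (v k j)) := fun k i j => by
    have hsq : ((√|l k| : ℝ) : ℂ) * ((√|l k| : ℝ) : ℂ) = (|l k| : ℝ) := by
      rw [← Complex.ofReal_mul, Real.mul_self_sqrt (abs_nonneg _)]
    simp only [v, PiLp.smul_apply, smul_eq_mul, map_mul, Complex.conj_ofReal]
    calc (l k : ℂ) * (b k i * starRingEnd ℂ (b k j))
        = ((s k * |l k| : ℝ) : ℂ) * (b k i * starRingEnd ℂ (b k j)) := by rw [hsl]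
      _ = _ := by
        rw [Complex.ofReal_mul, ← hsq]
        ring
  have hsum : ∀ i j, X i j =
      ∑ k with l k ≠ 0, (s k : ℂ) * (v k i * starRingEnd ℂ (v k j)) := fun i j => by
    have hspec : X i j = ∑ k, (l k : ℂ) * (b k i * starRingEnd ℂ (b k j)) := by
      conv_lhs => rw [hX.spectral_theorem, Unitary.conjStarAlgAut_apply]
      rw [Matrix.mul_apply]
      refine Finset.sum_congr rfl fun k _ => ?_
      rw [Matrix.mul_diagonal]
      simp [Matrix.star_apply, b, l]
      ring
    rw [hspec, Finset.sum_filter]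
    refine Finset.sum_congr rfl fun k _ => ?_
    rw [← hterm]
    split_ifs with h
    · rfl
    · simp [not_not.1 h]
  have hcard : (Finset.univ.filter fun k => l k ≠ 0).card ≤ 2 := by
    rwa [hX.rank_eq_card_non_zero_eigs, Fintype.card_subtype] at hrank
  have hcases : ∀ c ≤ 2, c = 0 ∨ c = 1 ∨ c = 2 := by omega
  rcases hcases _ hcard with h | h | h
  · rw [Finset.card_eq_zero] at h
    exact ⟨0, 0, 1, 1, by norm_num, by norm_num, by simp, fun i j => by rw [hsum, h]; simp⟩
  · obtain ⟨k, hk⟩ := Finset.card_eq_one.1 h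
    exact ⟨v k, 0, s k, 1, hs k, by norm_num, by simp, fun i j => by rw [hsum, hk]; simp⟩
  · obtain ⟨k, k', hne, hk⟩ := Finset.card_eq_two.1 h
    refine ⟨v k, v k', s k, s k', hs k, hs k', ?_, fun i j => by
      rw [hsum, hk, Finset.sum_pair hne]⟩
    simp only [v, inner_smul_left, inner_smul_right, b.orthonormal.2 hne, mul_zero]

variable {X : Matrix (Fin n) (Fin n) ℂ} {x y : EuclideanSpace ℂ (Fin n)} {s t : ℝ}

theorem sum_conj_mul_self (x : EuclideanSpace ℂ (Fin n)) :
    ∑ i, starRingEnd ℂ (x i) * x i = ((‖x‖ ^ 2 : ℝ) : ℂ) := by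
  rw [EuclideanSpace.norm_sq_eq, Complex.ofReal_sum]
  refine Finset.sum_congr rfl fun i _ => ?_
  rw [Complex.conj_mul', Complex.ofReal_pow]

theorem sum_conj_mul_eq_inner (x y : EuclideanSpace ℂ (Fin n)) :
    ∑ i, starRingEnd ℂ (x i) * y i = inner ℂ x y := by
  rw [PiLp.inner_apply]
  refine Finset.sum_congr rfl fun i _ => ?_
  rw [RCLike.inner_apply, mul_comm]

theorem quadMeas_eq_of_decomposition {m : ℕ} {X : HermMat n}
    (hX : ∀ i j, X.1 i j = s * (x i * starRingEnd ℂ (x j)) + t * (y i * starRingEnd ℂ (y j)))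
    (a : Fin m → Fin n → ℂ) (j : Fin m) :
    quadMeas a X j = s * ‖sesq (a j) x‖ ^ 2 + t * ‖sesq (a j) y‖ ^ 2 := by
  have hsq : ∀ z : EuclideanSpace ℂ (Fin n), ((‖sesq (a j) z‖ ^ 2 : ℝ) : ℂ) =
      ∑ i, ∑ k, starRingEnd ℂ (a j i) * z i * (starRingEnd ℂ (z k) * a j k) := fun z => by
    rw [Complex.ofReal_pow, ← Complex.mul_conj', sesq, map_sum, Finset.sum_mul_sum]
    refine Finset.sum_congr rfl fun i _ => Finset.sum_congr rfl fun k _ => ?_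
    rw [map_mul, Complex.conj_conj]
    ring
  have h : (star (a j) ⬝ᵥ X.1.mulVec (a j) : ℂ) =
      ((s * ‖sesq (a j) x‖ ^ 2 + t * ‖sesq (a j) y‖ ^ 2 : ℝ) : ℂ) := by
    rw [Complex.ofReal_add, Complex.ofReal_mul, Complex.ofReal_mul, hsq, hsq, Finset.mul_sum,
      Finset.mul_sum, ← Finset.sum_add_distrib]
    simp only [dotProduct, Matrix.mulVec, Pi.star_apply, hX, Finset.mul_sum,
      ← Finset.sum_add_distrib]
    refine Finset.sum_congr rfl fun i _ => Finset.sum_congr rfl fun k _ => ?_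
    rw [Complex.star_def]
    ring
  change (star (a j) ⬝ᵥ X.1.mulVec (a j)).re = _
  rw [h, Complex.ofReal_re]

theorem frobNorm_sq_of_decomposition (hxy : inner ℂ x y = 0) (hs : s ^ 2 = 1) (ht : t ^ 2 = 1)
    (hX : ∀ i j, X i j = s * (x i * starRingEnd ℂ (x j)) + t * (y i * starRingEnd ℂ (y j))) :
    frobNorm X ^ 2 = ‖x‖ ^ 4 + ‖y‖ ^ 4 := by
  rw [frobNorm_eq, Real.sq_sqrt (by positivity)]
  have hyx : inner ℂ y x = 0 := inner_eq_zero_symm.1 hxy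
  have hs' : (s : ℂ) ^ 2 = 1 := by exact_mod_cast hs
  have ht' : (t : ℂ) ^ 2 = 1 := by exact_mod_cast ht
  have hexpand : ∀ i j, ((‖X i j‖ ^ 2 : ℝ) : ℂ) =
      (starRingEnd ℂ (x i) * x i) * (starRingEnd ℂ (x j) * x j) +
      (starRingEnd ℂ (y i) * y i) * (starRingEnd ℂ (y j) * y j) +
      s * t * ((starRingEnd ℂ (y i) * x i) * (starRingEnd ℂ (x j) * y j)) +
      s * t * ((starRingEnd ℂ (x i) * y i) * (starRingEnd ℂ (y j) * x j)) := fun i j => by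
    rw [Complex.ofReal_pow, ← Complex.mul_conj', hX]
    simp only [map_add, map_mul, Complex.conj_conj, Complex.conj_ofReal]
    linear_combination
      (starRingEnd ℂ (x i) * x i) * (starRingEnd ℂ (x j) * x j) * hs' +
      (starRingEnd ℂ (y i) * y i) * (starRingEnd ℂ (y j) * y j) * ht'
  apply Complex.ofReal_injective
  rw [Complex.ofReal_sum]
  simp_rw [Complex.ofReal_sum, hexpand, Finset.sum_add_distrib, ← Finset.mul_sum,
    ← Finset.sum_mul, sum_conj_mul_self, sum_conj_mul_eq_inner, hxy, hyx]
  push_cast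
  ring

theorem apply_eq_zero_of_decomposition (hxy : inner ℂ x y = 0) (hs : s ^ 2 = 1)
    (hX : ∀ i j, X i j = s * (x i * starRingEnd ℂ (x j)) + t * (y i * starRingEnd ℂ (y j)))
    {i : Fin n} (hi : X i = 0) : x i = 0 := by
  have h : ∑ j, X i j * x j = s * x i * ((‖x‖ ^ 2 : ℝ) : ℂ) := by
    have hyx : ∑ j, starRingEnd ℂ (y j) * x j = 0 := by
      rw [sum_conj_mul_eq_inner, inner_eq_zero_symm.1 hxy]
    calc ∑ j, X i j * x j
        = s * x i * ∑ j, starRingEnd ℂ (x j) * x j + t * y i * ∑ j, starRingEnd ℂ (y j) * x j := by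
          rw [Finset.mul_sum, Finset.mul_sum, ← Finset.sum_add_distrib]
          refine Finset.sum_congr rfl fun j _ => ?_
          rw [hX]
          ring
      _ = _ := by rw [hyx, sum_conj_mul_self, mul_zero, add_zero]
  simp only [hi, Pi.zero_apply, zero_mul, Finset.sum_const_zero] at h
  have hs0 : (s : ℂ) ≠ 0 := by
    rintro h0
    rw [Complex.ofReal_eq_zero] at h0
    simp [h0] at hs
  rcases mul_eq_zero.1 h.symm with h | h
  · exact (mul_eq_zero.1 h).resolve_left hs0
  · have : x = 0 := by simpa using h
    simp [this]

end Spectral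

theorem satisfiesRIP_of_orthPairs {m n k : ℕ} (hm : 0 < m) (hkn : k ≤ n)
    {a : Fin m → Fin n → ℂ} {c C : ℝ} (hc : 0 < c) (hC : 0 < C)
    (h : ∀ S : Finset (Fin n), S.card = k → ∀ p ∈ orthPairs S, ∀ s : ℝ, s ^ 2 = 1 →
      c * m ≤ ∑ j, |‖sesq (a j) p.1‖ ^ 2 + s * ‖sesq (a j) p.2‖ ^ 2| ∧
        ∑ j, |‖sesq (a j) p.1‖ ^ 2 + s * ‖sesq (a j) p.2‖ ^ 2| ≤ C * m) :
    SatisfiesRIP (quadMeas a) 2 k c C := by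
  classical
  refine ⟨hc, hC, fun X hrank hrows => ?_⟩
  obtain ⟨x, y, s, t, hs, ht, hxy, hX⟩ := exists_signed_decomposition X.2 hrank
  have hfrob := frobNorm_sq_of_decomposition hxy hs ht hX
  have hX' : ∀ i j, X.1 i j = t * (y i * starRingEnd ℂ (y j)) + s * (x i * starRingEnd ℂ (x j)) :=
    fun i j => by rw [hX, add_comm]
  obtain ⟨S, hS, hScard⟩ : ∃ S : Finset (Fin n), (∀ i, X.1 i ≠ 0 → i ∈ S) ∧ S.card = k := by
    obtain ⟨S, hS, hScard⟩ := Finset.exists_superset_card_eq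
      (s := Finset.univ.filter fun i => X.1 i ≠ 0) (n := k)
      (by rwa [nonzeroRows, Set.ncard_eq_toFinset_card', Set.toFinset_ofPred] at hrows)
      (by simpa using hkn)
    exact ⟨S, fun i hi => hS (by simpa using hi), hScard⟩
  have hmem : ∀ i ∉ S, X.1 i = 0 := fun i hi => by
    by_contra h0
    exact hi (hS i h0)
  set r := frobNorm X.1 with hr
  have hr0 : 0 ≤ r := by
    rw [hr, frobNorm_eq]
    positivity
  rcases hr0.eq_or_lt with hr0 | hr0
  · have hx : ‖x‖ = 0 := by
      have : ‖x‖ ^ 4 = 0 := by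
        nlinarith [pow_nonneg (norm_nonneg x) 4, pow_nonneg (norm_nonneg y) 4]
      simpa using this
    have hy : ‖y‖ = 0 := by
      have : ‖y‖ ^ 4 = 0 := by
        nlinarith [pow_nonneg (norm_nonneg x) 4, pow_nonneg (norm_nonneg y) 4]
      simpa using this
    have hzero : ∀ j, quadMeas a X j = 0 := fun j => by
      rw [quadMeas_eq_of_decomposition hX, norm_eq_zero.1 hx, norm_eq_zero.1 hy]
      simp [sesq]
    simp [hzero, ← hr0]
  -- Rescale to Frobenius norm one.
  let d : ℂ := (((√r)⁻¹ : ℝ) : ℂ)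
  have hd : ‖d‖ ^ 2 = r⁻¹ := by
    rw [Complex.norm_real, Real.norm_eq_abs, sq_abs, inv_pow, Real.sq_sqrt hr0.le]
  have hsesq : ∀ j (z : EuclideanSpace ℂ (Fin n)),
      ‖sesq (a j) (d • z)‖ ^ 2 = r⁻¹ * ‖sesq (a j) z‖ ^ 2 := fun j z => by
    have : sesq (a j) (d • z) = d * sesq (a j) z := by
      simp only [sesq, PiLp.smul_apply, smul_eq_mul, Finset.mul_sum]
      exact Finset.sum_congr rfl fun i _ => by ring
    rw [this, norm_mul, mul_pow, hd]
  have hp : (d • x, d • y) ∈ orthPairs S := by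
    refine ⟨Submodule.smul_mem _ _ fun i hi => ?_, Submodule.smul_mem _ _ fun i hi => ?_, ?_, ?_⟩
    · exact apply_eq_zero_of_decomposition hxy hs hX (hmem i hi)
    · exact apply_eq_zero_of_decomposition (inner_eq_zero_symm.1 hxy) ht hX' (hmem i hi)
    · rw [inner_smul_left, inner_smul_right, hxy, mul_zero, mul_zero]
    · have h4 : ∀ z : EuclideanSpace ℂ (Fin n), ‖d • z‖ ^ 4 = (r ^ 2)⁻¹ * ‖z‖ ^ 4 := fun z => by
        rw [norm_smul, mul_pow, show ‖d‖ ^ 4 = (‖d‖ ^ 2) ^ 2 by ring, hd, inv_pow]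
      simp only [h4]
      rw [← mul_add, ← hfrob, inv_mul_cancel₀ (by positivity)]
  have hst : (s * t) ^ 2 = 1 := by rw [mul_pow, hs, ht, one_mul]
  have habs : |s| = 1 := by rwa [← sq_eq_sq₀ (abs_nonneg s) zero_le_one, sq_abs, one_pow]
  have hsum : ∑ j, |‖sesq (a j) (d • x)‖ ^ 2 + s * t * ‖sesq (a j) (d • y)‖ ^ 2| =
      r⁻¹ * ∑ j, |quadMeas a X j| := by
    rw [Finset.mul_sum]
    refine Finset.sum_congr rfl fun j _ => ?_
    rw [quadMeas_eq_of_decomposition hX, hsesq, hsesq]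
    calc |r⁻¹ * ‖sesq (a j) x‖ ^ 2 + s * t * (r⁻¹ * ‖sesq (a j) y‖ ^ 2)|
        = |s| * |r⁻¹ * ‖sesq (a j) x‖ ^ 2 + s * t * (r⁻¹ * ‖sesq (a j) y‖ ^ 2)| := by
          rw [habs, one_mul]
      _ = |r⁻¹ * (s * ‖sesq (a j) x‖ ^ 2 + t * ‖sesq (a j) y‖ ^ 2)| := by
          rw [← abs_mul]
          congr 1
          linear_combination (t * (r⁻¹ * ‖sesq (a j) y‖ ^ 2)) * hs
      _ = _ := by rw [abs_mul, abs_of_pos (inv_pos.2 hr0)]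
  have hm0 : (0 : ℝ) < m := by exact_mod_cast hm
  obtain ⟨h1, h2⟩ := h S hScard _ hp _ hst
  simp only [hsum] at h1 h2
  rw [inv_mul_eq_div] at h1 h2
  rw [le_div_iff₀ hr0] at h1
  rw [div_le_iff₀ hr0] at h2
  rw [one_div, inv_mul_eq_div, le_div_iff₀ hm0, div_le_iff₀ hm0]
  constructor <;> linarith

/-! ### The union bound -/

theorem choose_le_exp {n k : ℕ} (hk : 1 ≤ k) (hkn : k ≤ n) :
    (n.choose k : ℝ) ≤ Real.exp (k * Real.log (Real.exp 1 * n / k)) := by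
  have hk0 : (0 : ℝ) < k := by exact_mod_cast hk
  have hn0 : (0 : ℝ) < n := by exact_mod_cast hk.trans hkn
  have hfac : (k : ℝ) ^ k ≤ Real.exp 1 ^ k * k.factorial := by
    have h := Real.pow_div_factorial_le_exp (x := k) hk0.le k
    rwa [div_le_iff₀ (by positivity), ← mul_one (k : ℝ), Real.exp_nat_mul, mul_one] at h
  calc (n.choose k : ℝ) ≤ (n : ℝ) ^ k / k.factorial := Nat.choose_le_pow_div k n
    _ ≤ (Real.exp 1 * n / k) ^ k := by
      rw [div_pow, mul_pow, div_le_div_iff₀ (by positivity) (by positivity)]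
      nlinarith [pow_pos hn0 k]
    _ = Real.exp (k * Real.log (Real.exp 1 * n / k)) := by
      rw [Real.exp_nat_mul, Real.exp_log (by positivity)]

theorem le_mul_log_exp_mul_div {n k : ℕ} (hk : 1 ≤ k) (hkn : k ≤ n) :
    (k : ℝ) ≤ k * Real.log (Real.exp 1 * n / k) := by
  have hk0 : (0 : ℝ) < k := by exact_mod_cast hk
  refine le_mul_of_one_le_right hk0.le ?_
  rw [Real.le_log_iff_exp_le (by have : 0 < n := hk.trans hkn; positivity), le_div_iff₀ hk0]
  exact mul_le_mul_of_nonneg_left (by exact_mod_cast hkn) (Real.exp_pos _).le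

theorem card_mul_exp_le {n k : ℕ} (hk : 1 ≤ k) (hkn : k ≤ n) {m : ℝ}
    (hm : 40000 * ((k : ℝ) * Real.log (Real.exp 1 * n / k)) ≤ m) :
    (n.choose k : ℝ) * ((2001 : ℝ) ^ (4 * k) * (3 * Real.exp (-(1 / 520) * m))) ≤
      2 * Real.exp (-(1 / 1040) * m) := by
  have hl := le_mul_log_exp_mul_div hk hkn
  have hchoose := choose_le_exp hk hkn
  set l := (k : ℝ) * Real.log (Real.exp 1 * n / k)
  have hk1 : (1 : ℝ) ≤ k := by exact_mod_cast hk
  have h2001 : (2001 : ℝ) ^ (4 * k) ≤ Real.exp (32 * l) := by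
    have h : (2001 : ℝ) ≤ Real.exp 8 := by
      have he : (2.7 : ℝ) ≤ Real.exp 1 := by linarith [Real.exp_one_gt_d9]
      calc (2001 : ℝ) ≤ 2.7 ^ 8 := by norm_num
        _ ≤ Real.exp 1 ^ 8 := pow_le_pow_left₀ (by norm_num) he 8
        _ = Real.exp 8 := by rw [← Real.exp_nat_mul]; norm_num
    calc (2001 : ℝ) ^ (4 * k) ≤ Real.exp 8 ^ (4 * k) := pow_le_pow_left₀ (by norm_num) h _
      _ = Real.exp (32 * k) := by
        rw [← Real.exp_nat_mul]
        congr 1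
        push_cast
        ring
      _ ≤ Real.exp (32 * l) := Real.exp_le_exp.2 (by linarith)
  have h3 : (3 : ℝ) ≤ 2 * Real.exp l := by linarith [Real.add_one_le_exp l]
  calc (n.choose k : ℝ) * ((2001 : ℝ) ^ (4 * k) * (3 * Real.exp (-(1 / 520) * m)))
      ≤ Real.exp l * (Real.exp (32 * l) * ((2 * Real.exp l) * Real.exp (-(1 / 520) * m))) := by
        gcongr
    _ = 2 * Real.exp (34 * l - 1 / 520 * m) := by
        rw [show 34 * l - 1 / 520 * m = l + (32 * l + (l + -(1 / 520) * m)) by ring,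
          Real.exp_add, Real.exp_add, Real.exp_add]
        ring
    _ ≤ 2 * Real.exp (-(1 / 1040) * m) := by
        gcongr
        linarith

theorem theorem1 :
    ∃ K : ℝ, 0 < K ∧ ∃ c₀ : ℝ, 0 < c₀ ∧
      ∀ (n k m : ℕ), 1 ≤ k → k ≤ n →
        K * ((k : ℝ) * Real.log (Real.exp 1 * (n : ℝ) / (k : ℝ))) ≤ (m : ℝ) →
        ∀ (Ω : Type*) [MeasurableSpace Ω] (P : Measure Ω) [IsProbabilityMeasure P]
          (a : Fin m → Ω → (Fin n → ℂ)),
          (∀ j, HasLaw (a j) (stdComplexGaussianVec n) P) → iIndepFun a P →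
          1 - 2 * Real.exp (-c₀ * (m : ℝ)) ≤
            P.real {ω | SatisfiesRIP (quadMeas fun j => a j ω) 2 k 0.12 2.45} := by
  refine ⟨40000, by norm_num, 1 / 1040, by norm_num, ?_⟩
  intro n k m hk hkn hm Ω _ P _ a ha hind
  have hm0 : 0 < m := by
    have hk1 : (1 : ℝ) ≤ k := by exact_mod_cast hk
    have : (0 : ℝ) < m := by linarith [le_mul_log_exp_mul_div hk hkn]
    exact_mod_cast this
  choose N hNS hNcard hN using fun S : Finset (Fin n) =>
    exists_net_orthPairs S (show (0 : ℝ) < 1 / 1000 by norm_num)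
  let low : ℝ → EuclideanSpace ℂ (Fin n) × EuclideanSpace ℂ (Fin n) → Set Ω := fun s p =>
    {ω | ∑ j, |‖sesq (a j ω) p.1‖ ^ 2 + s * ‖sesq (a j ω) p.2‖ ^ 2| ≤ 0.13 * (m : ℝ)}
  let bad : EuclideanSpace ℂ (Fin n) × EuclideanSpace ℂ (Fin n) → Set Ω := fun p =>
    {ω | 1.5 * (m : ℝ) ≤ ∑ j, ‖sesq (a j ω) p.1‖ ^ 2} ∪ (low 1 p ∪ low (-1) p)
  let B : Set Ω := ⋃ S ∈ Finset.powersetCard k Finset.univ, ⋃ p ∈ N S, bad p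
  have hbad : ∀ S, ∀ p ∈ N S, P.real (bad p) ≤ 3 * Real.exp (-(1 / 520) * m) := fun S p hp => by
    have hpS := hNS S p hp
    have h1 := measureReal_upper_tail ha hind (norm_fst_le_one_of_mem_orthPairs hpS)
    have hlow : ∀ s : ℝ, s ^ 2 = 1 → P.real (low s p) ≤ Real.exp (-(1 / 520) * m) := fun s hs =>
      measureReal_lower_tail ha hind hpS.2.2.1 hpS.2.2.2 hs
    refine (measureReal_union_le _ _).trans ?_
    linarith [measureReal_union_le (μ := P) (low 1 p) (low (-1) p), hlow 1 (by norm_num),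
      hlow (-1) (by norm_num)]
  have hB : P.real B ≤ 2 * Real.exp (-(1 / 1040) * m) := by
    refine le_trans ?_ (card_mul_exp_le hk hkn hm)
    have hS : ∀ S ∈ Finset.powersetCard k (Finset.univ : Finset (Fin n)),
        P.real (⋃ p ∈ N S, bad p) ≤ (2001 : ℝ) ^ (4 * k) * (3 * Real.exp (-(1 / 520) * m)) := by
      intro S hS
      have hcard : ((N S).card : ℝ) ≤ (2001 : ℝ) ^ (4 * k) := by
        have h := hNcard S
        rw [(Finset.mem_powersetCard.1 hS).2] at h
        norm_num at h
        exact h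
      calc P.real (⋃ p ∈ N S, bad p) ≤ ∑ p ∈ N S, P.real (bad p) :=
            measureReal_biUnion_finset_le _ _
        _ ≤ (N S).card • (3 * Real.exp (-(1 / 520) * m)) := Finset.sum_le_card_nsmul _ _ _ (hbad S)
        _ ≤ _ := by
          rw [nsmul_eq_mul]
          gcongr
    calc P.real B ≤ ∑ S ∈ Finset.powersetCard k Finset.univ, P.real (⋃ p ∈ N S, bad p) :=
          measureReal_biUnion_finset_le _ _
      _ ≤ (Finset.powersetCard k (Finset.univ : Finset (Fin n))).card •
          ((2001 : ℝ) ^ (4 * k) * (3 * Real.exp (-(1 / 520) * m))) :=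
        Finset.sum_le_card_nsmul _ _ _ hS
      _ = _ := by rw [Finset.card_powersetCard, Finset.card_univ, Fintype.card_fin, nsmul_eq_mul]
  have hgood : Bᶜ ⊆ {ω | SatisfiesRIP (quadMeas fun j => a j ω) 2 k 0.12 2.45} := by
    intro ω hω
    have hω' : ∀ S : Finset (Fin n), S.card = k → ∀ p ∈ N S, ω ∉ bad p := by
      intro S hS p hp hbad
      exact hω (Set.mem_biUnion (Finset.mem_powersetCard.2 ⟨Finset.subset_univ S, hS⟩)
        (Set.mem_biUnion hp hbad))
    refine satisfiesRIP_of_orthPairs hm0 hkn (by norm_num) (by norm_num) ?_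
    intro S hS p hp s hs
    refine sum_abs_signed_bounds_of_net (hNS S) (hN S) (fun q hq => ?_) hs (fun q hq => ?_) hp
    · exact (not_le.1 fun h => hω' S hS q hq (Or.inl h)).le
    · rcases sq_eq_one_iff.1 hs with rfl | rfl
      · exact (not_le.1 fun h => hω' S hS q hq (Or.inr (Or.inl h))).le
      · exact (not_le.1 fun h => hω' S hS q hq (Or.inr (Or.inr h))).le
  -- The event need not be shown measurable: outer measure is subadditive.
  have huniv : (1 : ℝ) ≤ P.real B + P.real Bᶜ := by
    have h := measureReal_union_le (μ := P) B Bᶜ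
    rwa [Set.union_compl_self, probReal_univ] at h
  linarith [measureReal_mono (μ := P) hgood]
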